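/- **Setting.** Let $K$ be a finite simplicial complex and let $\mathbb F$ be a field; all homology groups $H_*$ are (unreduced) simplicial homology groups with coefficients in $\mathbb F$. Write $\sigma^{(p)}$ for a simplex of dimension $p$. A *discrete Morse function* is a function $f\colon K\to\mathbb R$ on the set of simplices such that for every $p$ and every $p$-simplex $\sigma$ of $K$ $$\#\{\tau^{(p+1)}\supset\sigma : f(\tau)\le f(\sigma)\}\le 1,\qquad \#\{\nu^{(p-1)}\subset\sigma : f(\sigma)\le f(\nu)\}\le 1 .$$ The simplex $\sigma$ is *critical* if both numbers are $0$, and $f$ is *excellent* if different critical simplices have different values. For $c\in\mathbb R$ let $K(c)$ be the subcomplex of $K$ consisting of all simplices with value $\le c$ and all their faces. A class $h\in H_q(K(b))$ is *born* at the value $b$ if it is not in the image of $H_q(K(a))\to H_q(K(b))$ for any $a<b$. According to the elder rule, such a class *dies* at the value $d>b$ if $d$ is the first value at which it becomes zero or merges with an older class, that is: the image of $h$ in $H_q(K(d))$ lies in the image of $H_q(K(a))\to H_q(K(d))$ for some $a<b$, and for no $c$ with $b\le c<d$ does the image of $h$ in $H_q(K(c))$ lie in the image of $H_q(K(a))\to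 H_q(K(c))$ for some $a<b$. A pair $(\sigma,\tau)$ of simplices of $K$ is a *persistence pair* if some homology class (of some degree) is born at the value $f(\sigma)$ and dies at the value $f(\tau)$; then $\sigma$ is its birth simplex and $\tau$ its death simplex. The simplex $\sigma$ is *paired with infinity*, written $(\sigma,\infty)$, if some homology class (of some degree) is born at $f(\sigma)$ and does not die at any value. **Theorem.** Let $f$ be an excellent discrete Morse function on $K$ and let $\sigma^{(q)}$ be a critical simplex of $f$. Then exactly one of the following holds: 1. $\sigma$ is the birth simplex of a persistence pair $(\sigma,\tau)$; 2. $\sigma$ is the death simplex of a persistence pair $(\alpha,\sigma)$; 3. $\sigma$ is paired with infinity, $(\sigma,\infty)$. In case 1 there is exactly one critical simplex $\tau$ such that $(\sigma,\tau)$ is a persistence pair, and $\dim\tau=q+1$. In case 2 there is exactly one critical simplex $\alpha$ such that $(\alpha,\sigma)$ is a persistence pair, and $\dim\alpha=q-1$. -/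

import Mathlib

/-!
Persistence pairs of discrete Morse functions on finite simplicial complexes.  A simplicial complex
is a `PreAbstractSimplicialComplex V`: a family of nonempty finite sets of vertices that is closed
under passing to nonempty subsets.  The vertices are linearly ordered, which orients all simplices.
-/

namespace DMorse

noncomputable section

section Subquotient

variable {F M : Type*} [Field F] [AddCommGroup M] [Module F M]

/-- The quotient `Z / B` of subspaces `B ≤ Z` of a vector space. -/
abbrev Subquotient (Z B : Submodule F M) : Type _ := Z ⧸ B.submoduleOf Z

/-- The map `Z / B → Z' / B'` induced by inclusions `Z ≤ Z'` and `B ≤ B'`. -/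
def subquotientMap {Z B Z' B' : Submodule F M} (hZ : Z ≤ Z') (hB : B ≤ B') :
    Subquotient Z B →ₗ[F] Subquotient Z' B' :=
  Submodule.mapQ _ _ (Submodule.inclusion hZ) fun _ hx => hB hx

end Subquotient

section Homology

variable {V : Type*} (F : Type*) [Field F]

/-- `C_q(K; F)`: linear combinations of the `q`-dimensional simplices of `K`. -/
def chains (K : PreAbstractSimplicialComplex V) (q : ℕ) : Submodule F (Finset V →₀ F) :=
  Finsupp.supported F F {s : Finset V | s ∈ K ∧ s.card = q + 1}

theorem chains_mono (q : ℕ) {K L : PreAbstractSimplicialComplex V} (h : K ≤ L) :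
    chains F K q ≤ chains F L q :=
  Finsupp.supported_mono fun _ hs => ⟨h hs.1, hs.2⟩

variable [LinearOrder V]

/-- The boundary `∂[v₀ < ⋯ < v_q] = ∑ i, (-1)^i [v₀, …, v̂ᵢ, …, v_q]` of an oriented simplex `s`;
it is `0` when `s` is a vertex (the homology is not reduced). -/
def simplexBoundary (s : Finset V) : Finset V →₀ F :=
  if s.card ≤ 1 then 0
  else ∑ v ∈ s, Finsupp.single (s.erase v) ((-1 : F) ^ (s.filter (· < v)).card)

/-- The boundary operator, on formal linear combinations of finite vertex sets. -/
def boundary : (Finset V →₀ F) →ₗ[F] (Finset V →₀ F) :=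
  Finsupp.linearCombination F (simplexBoundary F)

theorem boundary_single (s : Finset V) (a : F) :
    boundary F (Finsupp.single s a) = a • simplexBoundary F s := by
  simp [boundary]

theorem boundary_simplexBoundary (s : Finset V) : boundary F (simplexBoundary F s) = 0 := by
  classical
  unfold simplexBoundary
  split_ifs with h
  · simp
  rw [map_sum]
  simp only [boundary_single, simplexBoundary]
  by_cases h2 : s.card = 2
  · refine Finset.sum_eq_zero fun v hv => ?_
    rw [if_pos (by rw [Finset.card_erase_of_mem hv]; omega), smul_zero]
  have h3 : ∀ v ∈ s, ¬ (s.erase v).card ≤ 1 := fun v hv => by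
    rw [Finset.card_erase_of_mem hv]; omega
  rw [Finset.sum_congr rfl fun v hv => by rw [if_neg (h3 v hv), Finset.smul_sum]]
  rw [Finset.sum_sigma']
  refine Finset.sum_involution (fun p _ => ⟨p.2, p.1⟩) ?_ ?_ ?_ ?_
  · rintro ⟨v, w⟩ hp
    simp only [Finset.mem_sigma, Finset.mem_erase] at hp
    obtain ⟨hv, hwv, hw⟩ := hp
    simp only [Finsupp.smul_single, smul_eq_mul]
    rw [Finset.erase_right_comm (a := w), ← Finsupp.single_add, Finsupp.single_eq_zero]
    have key : ∀ x y : V, x ∈ s → y ∈ s → x < y →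
        (s.filter (· < y)).card = ((s.erase x).filter (· < y)).card + 1 ∧
        (s.filter (· < x)).card = ((s.erase y).filter (· < x)).card := by
      intro x y hx hy hxy
      constructor
      · rw [Finset.filter_erase, Finset.card_erase_add_one]
        simp [hx, hxy]
      · rw [Finset.filter_erase, Finset.erase_eq_of_notMem]
        simp [hxy.le]
    rcases lt_or_gt_of_ne hwv with h' | h'
    · obtain ⟨e1, e2⟩ := key w v hw hv h'
      rw [e1, e2]; ring
    · obtain ⟨e1, e2⟩ := key v w hv hw h'
      rw [e1, e2]; ring
  · rintro ⟨v, w⟩ hp _ heq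
    simp only [Finset.mem_sigma, Finset.mem_erase] at hp
    simp only [Sigma.mk.injEq] at heq
    exact hp.2.1 heq.1
  · rintro ⟨v, w⟩ hp
    simp only [Finset.mem_sigma, Finset.mem_erase] at hp ⊢
    exact ⟨hp.2.2, hp.2.1.symm, hp.1⟩
  · rintro ⟨v, w⟩ _
    rfl

/-- `∂ ∘ ∂ = 0`. -/
theorem boundary_boundary (c : Finset V →₀ F) : boundary F (boundary F c) = 0 := by
  induction c using Finsupp.induction_linear with
  | zero => simp
  | add f g hf hg => simp [hf, hg]
  | single s a => rw [boundary_single, map_smul, boundary_simplexBoundary, smul_zero]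

variable (K : PreAbstractSimplicialComplex V) (q : ℕ)

/-- `Z_q(K) = ker (∂ : C_q(K) → C_{q-1}(K))`. -/
def cycles : Submodule F (Finset V →₀ F) :=
  chains F K q ⊓ LinearMap.ker (boundary F)

/-- `B_q(K) = im (∂ : C_{q+1}(K) → C_q(K))`. -/
def boundaries : Submodule F (Finset V →₀ F) :=
  (chains F K (q + 1)).map (boundary F)

/-- Boundaries are cycles, so that the quotient below is the usual one. -/
theorem boundaries_le_cycles :
    boundaries F K q ≤ cycles F K q := by
  rintro _ ⟨c, hc, rfl⟩
  refine ⟨?_, boundary_boundary F c⟩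
  rw [boundary, Finsupp.linearCombination_apply]
  refine Submodule.sum_mem _ fun s hs => Submodule.smul_mem _ _ ?_
  obtain ⟨hsK, hsc⟩ := hc hs
  rw [simplexBoundary, if_neg (by omega)]
  refine Submodule.sum_mem _ fun v hv => Finsupp.single_mem_supported _ _ ⟨?_, ?_⟩
  · refine (K.isRelLowerSet_faces hsK).2 (Finset.erase_subset v s) ?_
    rw [← Finset.card_pos, Finset.card_erase_of_mem hv]; omega
  · rw [Finset.card_erase_of_mem hv]; omega

/-- `H_q(K) = Z_q(K) / B_q(K)`. -/
abbrev Homology : Type _ :=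
  Subquotient (cycles F K q) (boundaries F K q)

variable {K} {L : PreAbstractSimplicialComplex V}

theorem cycles_mono (h : K ≤ L) : cycles F K q ≤ cycles F L q :=
  inf_le_inf_right _ (chains_mono F q h)

theorem boundaries_mono (h : K ≤ L) : boundaries F K q ≤ boundaries F L q :=
  Submodule.map_mono (chains_mono F (q + 1) h)

/-- The map `H_q(K) → H_q(L)` induced by the inclusion of a subcomplex `K` into `L`. -/
def homologyMap (h : K ≤ L) : Homology F K q →ₗ[F] Homology F L q :=
  subquotientMap (cycles_mono F q h) (boundaries_mono F q h)

end Homology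

section Morse

variable {V : Type*} {K : PreAbstractSimplicialComplex V}

/-- The dimension of a simplex; simplices are nonempty, so the subtraction does not truncate. -/
def dim (σ : K) : ℕ := (σ : Finset V).card - 1

/-- `α` is a face of `β` of codimension one. -/
def IsFacet (α β : K) : Prop := (α : Finset V) ⊆ β ∧ dim β = dim α + 1

/-- Discrete Morse functions. -/
def IsDiscreteMorse (f : K → ℝ) : Prop :=
  ∀ σ : K, {τ : K | IsFacet σ τ ∧ f τ ≤ f σ}.encard ≤ 1 ∧
    {ν : K | IsFacet ν σ ∧ f σ ≤ f ν}.encard ≤ 1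

/-- Critical simplices of `f`. -/
def IsCritical (f : K → ℝ) (σ : K) : Prop :=
  {τ : K | IsFacet σ τ ∧ f τ ≤ f σ}.encard = 0 ∧
    {ν : K | IsFacet ν σ ∧ f σ ≤ f ν}.encard = 0

/-- Excellent discrete Morse functions: different critical simplices have different values. -/
def IsExcellent (f : K → ℝ) : Prop :=
  IsDiscreteMorse f ∧ ∀ σ τ : K, IsCritical f σ → IsCritical f τ → f σ = f τ → σ = τ

/-- The sub-level complex `K(c)`: all simplices with value at most `c`, and all their faces. -/
def sublevel (f : K → ℝ) (c : ℝ) : PreAbstractSimplicialComplex V where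
  faces := {s : Finset V | s.Nonempty ∧ ∃ σ : K, f σ ≤ c ∧ s ⊆ σ}
  isRelLowerSet_faces := by
    rintro s ⟨hs, σ, hσ, hsσ⟩
    exact ⟨hs, fun t hts ht => ⟨ht, σ, hσ, hts.trans hsσ⟩⟩

theorem sublevel_mono (f : K → ℝ) {a b : ℝ} (h : a ≤ b) : sublevel f a ≤ sublevel f b := by
  rintro s ⟨hs, σ, hσ, hsσ⟩
  exact ⟨hs, σ, hσ.trans h, hsσ⟩

end Morse

section Persistence

variable {V : Type*} [LinearOrder V] {K : PreAbstractSimplicialComplex V}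
  (F : Type*) [Field F] (f : K → ℝ)

/-- The map `H_q(K(a)) → H_q(K(b))` induced by inclusion, for `a ≤ b`. -/
def levelMap (q : ℕ) {a b : ℝ} (h : a ≤ b) :
    Homology F (sublevel f a) q →ₗ[F] Homology F (sublevel f b) q :=
  homologyMap F q (sublevel_mono f h)

variable {F f} {q : ℕ} {b : ℝ}

/-- The class `h` of `H_q(K(b))` is born at the value `b`: it does not come from any earlier
sub-level complex. -/
def IsBorn (h : Homology F (sublevel f b) q) : Prop :=
  ∀ (a : ℝ) (hab : a < b), h ∉ LinearMap.range (levelMap F f q hab.le)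

/-- In `H_q(K(d))` the class `h` of `H_q(K(b))` has become equal to (the image of) a class that is
older than the value `b`, for instance to zero. -/
def HasMerged (h : Homology F (sublevel f b) q) {d : ℝ} (hbd : b ≤ d) : Prop :=
  ∃ (a : ℝ) (hab : a < b),
    levelMap F f q hbd h ∈ LinearMap.range (levelMap F f q (hab.le.trans hbd))

/-- The class `h`, born at the value `b`, dies at the value `d` according to the elder rule:
`d` is the first value at which `h` becomes zero or merges with an older class. -/
def DiesAt (h : Homology F (sublevel f b) q) (d : ℝ) : Prop :=
  ∃ hbd : b < d, HasMerged h hbd.le ∧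
    ∀ (c : ℝ) (hbc : b ≤ c), c < d → ¬ HasMerged h hbc

variable (F f)

/-- `(σ, τ)` is a persistence pair: some homology class is born at `σ` and dies at `τ`. -/
def IsPersistencePair (σ τ : K) : Prop :=
  ∃ (q : ℕ) (h : Homology F (sublevel f (f σ)) q), IsBorn h ∧ DiesAt h (f τ)

/-- `(σ, ∞)` is a persistence pair: some homology class is born at `σ` and does not die. -/
def IsPairedWithInfinity (σ : K) : Prop :=
  ∃ (q : ℕ) (h : Homology F (sublevel f (f σ)) q), IsBorn h ∧ ¬ ∃ d : ℝ, DiesAt h d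

end Persistence

end

end DMorse

/-! Let no value of `f` lie strictly between `a` and `c`, where `a < c`. Several noncritical
simplices may enter between K(a) and K(c) at once, but at most one critical simplex has value `c`.
The new noncritical simplices contribute nothing to homology: in a chain of K(c), the lower simplex
of a gradient pair can be exchanged for old simplices by adding a multiple of the boundary of the
upper one. An upper simplex that then remains would leave its lower facet in the boundary of the
chain. Hence a chain whose boundary lies in K(a) is, modulo boundaries in K(c), a chain of K(a) plus
a multiple of the critical simplex σ of value `c` (`exists_sub_mem_supported`,
`IsExcellent.exists_decomposition`).

So σ has one of two effects. If ∂σ already bounds in K(a), σ is positive: it adds one generator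
modulo older classes and kills nothing. Otherwise σ is negative: no class is born, and ∂σ is the
only new relation up to scalars, modulo boundaries of K(a). All classes born at a positive σ agree
up to a nonzero scalar and older classes, so they share one fate: death at one value, at a negative
simplex one dimension higher, or survival forever.

For a negative σ, let β realize the first value such that [∂σ] in H(K(a)) comes from K(f β). A
representative there is born at f β, because f β is minimal, and it dies at σ. A class dying at σ
differs from an older one by a cycle homologous in K(a) to a nonzero multiple of ∂σ. Its birth value
is at least f β by minimality, and cannot be larger, since the class would then have merged before
σ. -/

namespace DMorse

/-! ### Gradient pairs and sub-level complexes -/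

section Combinatorics

variable {V : Type*} {K : PreAbstractSimplicialComplex V}

theorem card_eq_dim_add_one (σ : K) : (σ : Finset V).card = dim σ + 1 := by
  have h : 0 < (σ : Finset V).card := Finset.card_pos.2 (K.isRelLowerSet_faces σ.2).1
  unfold dim
  omega

theorem isFacet_iff {α β : K} :
    IsFacet α β ↔ (α : Finset V) ⊆ β ∧ (β : Finset V).card = (α : Finset V).card + 1 := by
  rw [IsFacet, card_eq_dim_add_one, card_eq_dim_add_one]
  simp

theorem IsFacet.card {α β : K} (h : IsFacet α β) :
    (β : Finset V).card = (α : Finset V).card + 1 := (isFacet_iff.1 h).2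

theorem mem_of_subset {s : Finset V} (hs : s.Nonempty) {t : K} (hst : s ⊆ t) : s ∈ K :=
  (K.isRelLowerSet_faces t.2).2 hst hs

/-- Between two simplices whose dimensions differ by at least two there are two different facets of
the larger one. -/
theorem exists_two_facets {s t : K} (hst : (s : Finset V) ⊆ t)
    (hc : (s : Finset V).card + 2 ≤ (t : Finset V).card) :
    ∃ u v : K, u ≠ v ∧ IsFacet u t ∧ IsFacet v t ∧ (s : Finset V) ⊆ u ∧ (s : Finset V) ⊆ v := by
  classical
  have h1 : 1 < ((t : Finset V) \ s).card := by
    rw [Finset.card_sdiff_of_subset hst]; omega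
  obtain ⟨x, hx, y, hy, hxy⟩ := Finset.one_lt_card.1 h1
  rw [Finset.mem_sdiff] at hx hy
  have hs := (K.isRelLowerSet_faces s.2).1
  have key : ∀ z ∈ (t : Finset V), z ∉ (s : Finset V) →
      ∃ u : K, (u : Finset V) = (t : Finset V).erase z ∧ IsFacet u t ∧ (s : Finset V) ⊆ u := by
    intro z hz hzs
    have hsub : (s : Finset V) ⊆ (t : Finset V).erase z := Finset.subset_erase.2 ⟨hst, hzs⟩
    refine ⟨⟨_, mem_of_subset (hs.mono hsub) (Finset.erase_subset z t)⟩, rfl, ?_, hsub⟩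
    exact isFacet_iff.2 ⟨Finset.erase_subset z t, (Finset.card_erase_add_one hz).symm⟩
  obtain ⟨u, hu, hut, hsu⟩ := key x hx.1 hx.2
  obtain ⟨v, hv, hvt, hsv⟩ := key y hy.1 hy.2
  refine ⟨u, v, ?_, hut, hvt, hsu, hsv⟩
  intro huv
  rw [huv, hv] at hu
  have : x ∈ (t : Finset V).erase y := Finset.mem_erase.2 ⟨hxy, hx.1⟩
  rw [hu] at this
  simp at this

variable {f : K → ℝ} {c : ℝ}

theorem IsDiscreteMorse.facet_unique (hf : IsDiscreteMorse f) {τ ν ν' : K} (h : IsFacet ν τ)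
    (h' : IsFacet ν' τ) (hν : f τ ≤ f ν) (hν' : f τ ≤ f ν') : ν = ν' :=
  Set.encard_le_one_iff.1 (hf τ).2 ν ν' ⟨h, hν⟩ ⟨h', hν'⟩

theorem IsDiscreteMorse.cofacet_unique (hf : IsDiscreteMorse f) {σ τ τ' : K} (h : IsFacet σ τ)
    (h' : IsFacet σ τ') (hτ : f τ ≤ f σ) (hτ' : f τ' ≤ f σ) : τ = τ' :=
  Set.encard_le_one_iff.1 (hf σ).1 τ τ' ⟨h, hτ⟩ ⟨h', hτ'⟩

theorem IsCritical.lt_cofacet {σ τ : K} (hσ : IsCritical f σ) (h : IsFacet σ τ) : f σ < f τ := by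
  by_contra! hle
  exact Set.eq_empty_iff_forall_notMem.1 (Set.encard_eq_zero.1 hσ.1) τ ⟨h, hle⟩

theorem IsCritical.facet_lt {σ ν : K} (hσ : IsCritical f σ) (h : IsFacet ν σ) : f ν < f σ := by
  by_contra! hle
  exact Set.eq_empty_iff_forall_notMem.1 (Set.encard_eq_zero.1 hσ.2) ν ⟨h, hle⟩

theorem isCritical_of_forall {σ : K} (h₁ : ∀ τ, IsFacet σ τ → f σ < f τ)
    (h₂ : ∀ ν, IsFacet ν σ → f ν < f σ) : IsCritical f σ := by
  constructor <;> rw [Set.encard_eq_zero, Set.eq_empty_iff_forall_notMem]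
  · rintro τ ⟨hτ, hle⟩
    exact (h₁ τ hτ).not_ge hle
  · rintro ν ⟨hν, hle⟩
    exact (h₂ ν hν).not_ge hle

/-- Forman's lemma: a face of a simplex of value at most `c` has value at most `c`, or one of its
cofacets has. -/
theorem IsDiscreteMorse.le_or_exists_cofacet (hf : IsDiscreteMorse f) {s t : K}
    (hst : (s : Finset V) ⊆ t) (ht : f t ≤ c) : f s ≤ c ∨ ∃ τ, IsFacet s τ ∧ f τ ≤ c := by
  induction hn : (t : Finset V).card using Nat.strong_induction_on generalizing t with
  | _ n ih =>
  have hle := Finset.card_le_card hst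
  rcases lt_or_ge (t : Finset V).card ((s : Finset V).card + 2) with hlt | hge
  · rcases (show (t : Finset V).card = (s : Finset V).card ∨
        (t : Finset V).card = (s : Finset V).card + 1 by omega) with h | h
    · left
      rwa [Subtype.ext (Finset.eq_of_subset_of_card_le hst h.le)]
    · exact .inr ⟨t, isFacet_iff.2 ⟨hst, h⟩, ht⟩
  · obtain ⟨u, v, huv, hu, hv, hsu, hsv⟩ := exists_two_facets hst hge
    -- At most one facet of `t` has value at least `f t`, so one of the two can replace `t` without
    -- raising the value.
    by_cases hfu : f t ≤ f u
    · have hfv : f v < f t := by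
        by_contra! hfv
        exact huv (hf.facet_unique hu hv hfu hfv)
      exact ih _ (by have := hv.card; omega) hsv (hfv.le.trans ht) rfl
    · exact ih _ (by have := hu.card; omega) hsu ((not_le.1 hfu).le.trans ht) rfl

/-- `a < c`, and no simplex has a value strictly between `a` and `c`. -/
def IsPred (f : K → ℝ) (a c : ℝ) : Prop := a < c ∧ ∀ σ : K, f σ < c → f σ ≤ a

theorem exists_isPred (hK : (K : Set (Finset V)).Finite) (f : K → ℝ) {b c : ℝ} (hbc : b < c) :
    ∃ a, b ≤ a ∧ IsPred f a c := by
  have : Finite K := hK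
  -- Adding `b` to the values of `f` keeps the set nonempty when `c` is below or equal to all of
  -- them, and forces `b ≤ a`.
  obtain ⟨a, ⟨ha, hac⟩, hmax⟩ := Set.Finite.exists_maximal (s := insert b (Set.range f) ∩ Set.Iio c)
    (((Set.finite_range f).insert b).inter_of_left _) ⟨b, by simp, hbc⟩
  have hm : ∀ x ∈ insert b (Set.range f) ∩ Set.Iio c, x ≤ a := fun x hx =>
    (le_total x a).elim id fun h => hmax hx h
  exact ⟨a, hm b ⟨by simp, hbc⟩, hac, fun σ hσ => hm _ ⟨by simp, hσ⟩⟩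

theorem mem_sublevel_of_le {σ τ : K} (hστ : (σ : Finset V) ⊆ τ) (h : f τ ≤ c) :
    (σ : Finset V) ∈ sublevel f c :=
  ⟨(K.isRelLowerSet_faces σ.2).1, τ, h, hστ⟩

theorem sublevel_le_of_forall {a b : ℝ} (h : ∀ σ : K, f σ ≤ a → f σ ≤ b) :
    sublevel f a ≤ sublevel f b := by
  rintro s ⟨hs, σ, hσ, hsσ⟩
  exact ⟨hs, σ, h σ hσ, hsσ⟩

theorem exists_of_mem_sublevel {s : Finset V} (h : s ∈ sublevel f c) :
    ∃ σ : K, (σ : Finset V) = s := by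
  obtain ⟨hs, σ, -, hsσ⟩ := h
  exact ⟨⟨s, mem_of_subset hs hsσ⟩, rfl⟩

/-- The critical simplices of value `c`, as vertex sets. -/
def criticalFaces (f : K → ℝ) (c : ℝ) : Set (Finset V) :=
  {s | ∃ σ : K, (σ : Finset V) = s ∧ IsCritical f σ ∧ f σ = c}

variable {a : ℝ}

theorem IsPred.mem_sublevel_of_lt (h : IsPred f a c) {σ τ : K} (hστ : (σ : Finset V) ⊆ τ)
    (hτ : f τ < c) : (σ : Finset V) ∈ sublevel f a :=
  mem_sublevel_of_le hστ (h.2 τ hτ)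

theorem IsPred.le_of_notMem (h : IsPred f a c) {σ τ : K} (hστ : (σ : Finset V) ⊆ τ)
    (hσ : (σ : Finset V) ∉ sublevel f a) : c ≤ f τ := by
  by_contra! hlt
  exact hσ (h.mem_sublevel_of_lt hστ hlt)

theorem IsPred.sublevel_le (h : IsPred f a c) {a' : ℝ} (ha' : a' < c) :
    sublevel f a' ≤ sublevel f a :=
  sublevel_le_of_forall fun σ hσ => h.2 σ (hσ.trans_lt ha')

/-- A simplex of `K(c)` that is not in an earlier sub-level complex has value `c` or has a cofacet
of value `c`. -/
theorem IsDiscreteMorse.eq_or_exists_cofacet (hf : IsDiscreteMorse f) (h : IsPred f a c) {σ : K}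
    (hσ : (σ : Finset V) ∈ sublevel f c) (hσ' : (σ : Finset V) ∉ sublevel f a) :
    f σ = c ∨ ∃ τ, IsFacet σ τ ∧ f τ = c := by
  obtain ⟨-, t, ht, hst⟩ := hσ
  rcases hf.le_or_exists_cofacet hst ht with hs | ⟨τ, hτ, hle⟩
  · exact .inl (hs.antisymm (h.le_of_notMem subset_rfl hσ'))
  · exact .inr ⟨τ, hτ, hle.antisymm (h.le_of_notMem hτ.1 hσ')⟩

/-- If `τ` has value `c`, then at most one of its facets is not in an earlier sub-level complex. -/
theorem IsDiscreteMorse.facet_mem_sublevel (hf : IsDiscreteMorse f) (h : IsPred f a c) {τ ν ν' : K}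
    (hτ : f τ = c) (hν : IsFacet ν τ) (hν' : IsFacet ν' τ) (hne : ν' ≠ ν)
    (hνa : (ν : Finset V) ∉ sublevel f a) : (ν' : Finset V) ∈ sublevel f a := by
  by_contra hν'a
  exact hne (hf.facet_unique hν' hν (hτ.le.trans (h.le_of_notMem subset_rfl hν'a))
    (hτ.le.trans (h.le_of_notMem subset_rfl hνa)))

/-- A facet of value at least `c` of a simplex of value `c` is not in an earlier sub-level
complex. -/
theorem IsDiscreteMorse.notMem_sublevel_of_le (hf : IsDiscreteMorse f) (hac : a < c) {τ ν : K}
    (hτ : f τ = c) (hν : IsFacet ν τ) (hle : c ≤ f ν) : (ν : Finset V) ∉ sublevel f a := by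
  rintro ⟨-, t, ht, hst⟩
  rcases hf.le_or_exists_cofacet hst ht with hs | ⟨τ', hτ', hle'⟩
  · linarith
  · have := hf.cofacet_unique hν hτ' (by linarith) (by linarith)
    subst this
    linarith

/-- A large value alone does not keep a simplex out of K(a), which also contains all faces of its
simplices. By Forman's lemma a cofacet of value at most `a` would be needed, and criticality forbids
it. -/
theorem IsCritical.notMem_sublevel (hf : IsDiscreteMorse f) {σ : K} (hσ : IsCritical f σ)
    (ha : a < f σ) : (σ : Finset V) ∉ sublevel f a := by
  rintro ⟨-, t, ht, hst⟩
  rcases hf.le_or_exists_cofacet hst ht with hs | ⟨τ, hτ, hle⟩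
  · linarith
  · linarith [hσ.lt_cofacet hτ]

end Combinatorics

/-! ### Chains with prescribed support -/

section Support

variable {V F : Type*} [Field F]

theorem mem_supported_of_forall {S : Set (Finset V)} {x : Finset V →₀ F}
    (h : ∀ s, x s ≠ 0 → s ∈ S) : x ∈ Finsupp.supported F F S :=
  fun s hs => h s (Finsupp.mem_support_iff.1 hs)

theorem mem_of_mem_supported {S : Set (Finset V)} {x : Finset V →₀ F}
    (h : x ∈ Finsupp.supported F F S) {s : Finset V} (hs : x s ≠ 0) : s ∈ S :=
  h (Finsupp.mem_support_iff.2 hs)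

theorem chains_le_supported_union {q : ℕ} (S : Set (Finset V))
    (L : PreAbstractSimplicialComplex V) :
    chains F L q ≤ Finsupp.supported F F ((L : Set (Finset V)) ∪ S) :=
  Finsupp.supported_mono fun _ hs => .inl hs.1

end Support

/-! ### Eliminating the gradient pairs of one value -/

section Reduction

variable {V : Type*} [LinearOrder V] {K : PreAbstractSimplicialComplex V} {F : Type*} [Field F]

theorem exists_isFacet_of_simplexBoundary_ne_zero {σ : K} {s : Finset V}
    (h : simplexBoundary F (σ : Finset V) s ≠ 0) : ∃ ν : K, (ν : Finset V) = s ∧ IsFacet ν σ := by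
  unfold simplexBoundary at h
  split_ifs at h with hc
  · simp at h
  rw [Finsupp.finsetSum_apply] at h
  obtain ⟨v, hv, hvs⟩ := Finset.exists_ne_zero_of_sum_ne_zero h
  have hs : (σ : Finset V).erase v = s := by
    by_contra hne
    exact hvs (Finsupp.single_eq_of_ne (Ne.symm hne))
  have hcard := Finset.card_erase_add_one hv
  subst hs
  refine ⟨⟨_, mem_of_subset ?_ (Finset.erase_subset v σ)⟩, rfl,
    isFacet_iff.2 ⟨Finset.erase_subset v σ, hcard.symm⟩⟩
  rw [← Finset.card_pos]; omega

theorem simplexBoundary_ne_zero_of_isFacet {ν σ : K} (h : IsFacet ν σ) :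
    simplexBoundary F (σ : Finset V) ν ≠ 0 := by
  have hν : 0 < (ν : Finset V).card := Finset.card_pos.2 (K.isRelLowerSet_faces ν.2).1
  have hcard := h.card
  obtain ⟨v, hv⟩ : ∃ v, (σ : Finset V) \ ν = {v} := by
    rw [← Finset.card_eq_one, Finset.card_sdiff_of_subset h.1]; omega
  have hvσ : v ∈ (σ : Finset V) := (Finset.mem_sdiff.1 (hv ▸ Finset.mem_singleton_self v)).1
  have hνe : (σ : Finset V).erase v = ν := by
    rw [Finset.erase_eq, ← hv, Finset.sdiff_sdiff_eq_self h.1]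
  unfold simplexBoundary
  rw [if_neg (by omega), Finsupp.finsetSum_apply, Finset.sum_eq_single_of_mem v hvσ]
  · rw [hνe, Finsupp.single_eq_same]
    exact pow_ne_zero _ (by simp)
  · intro w hw hwv
    refine Finsupp.single_eq_of_ne fun he => hwv ?_
    exact Finset.erase_injOn _ hw hvσ (he.symm.trans hνe.symm)

theorem boundary_apply (x : Finset V →₀ F) (s : Finset V) :
    boundary F x s = x.sum fun t r => r * simplexBoundary F t s := by
  rw [boundary, Finsupp.linearCombination_apply, Finsupp.sum_apply]
  rfl

theorem boundaries_le_chains (L : PreAbstractSimplicialComplex V) (q : ℕ) :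
    boundaries F L q ≤ chains F L q :=
  (boundaries_le_cycles F L q).trans inf_le_left

/-- The simplices of `K(c)` that are not facets of a simplex of value `c`, unless they are in
`K(a)`. -/
def unpairedFaces (f : K → ℝ) (a c : ℝ) : Set (Finset V) :=
  {s | s ∈ sublevel f c ∧
    (s ∈ sublevel f a ∨ ∀ σ τ : K, (σ : Finset V) = s → IsFacet σ τ → f τ ≠ c)}

variable {f : K → ℝ} {a c : ℝ}

/-- Modulo boundaries, the lower simplices of the gradient pairs of value `c` can be removed from
every chain. -/
theorem chains_le_unpaired_sup_boundaries (hf : IsDiscreteMorse f) (h : IsPred f a c) (q : ℕ) :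
    chains F (sublevel f c) q ≤
      Finsupp.supported F F (unpairedFaces f a c ∩ {s | s.card = q + 1}) ⊔
        boundaries F (sublevel f c) q := by
  rw [chains, Finsupp.supported_eq_span_single, Submodule.span_le]
  rintro _ ⟨s, ⟨hs, hsq⟩, rfl⟩
  by_cases hsu : s ∈ unpairedFaces f a c
  · exact Submodule.mem_sup_left (Finsupp.single_mem_supported _ _ ⟨hsu, hsq⟩)
  have hsu' := hsu
  simp only [unpairedFaces, Set.mem_ofPred_eq, not_and, not_or, not_forall, not_not] at hsu'
  obtain ⟨hsa, σ, τ, rfl, hστ, hτ⟩ := hsu' hs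
  have hτc : (τ : Finset V) ∈ sublevel f c := mem_sublevel_of_le subset_rfl hτ.le
  set ε := simplexBoundary F (τ : Finset V) σ with hε
  have hε0 : ε ≠ 0 := simplexBoundary_ne_zero_of_isFacet hστ
  -- Subtracting ∂τ cancels σ; every other facet of τ is already in K(a), so no other lower simplex
  -- of a pair is introduced.
  have hrest : Finsupp.single (σ : Finset V) ε - simplexBoundary F (τ : Finset V) ∈
      Finsupp.supported F F (unpairedFaces f a c ∩ {s | s.card = q + 1}) := by
    refine mem_supported_of_forall fun t ht => ?_
    have hts : t ≠ σ := by
      rintro rfl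
      simp [hε] at ht
    rw [Finsupp.sub_apply, Finsupp.single_eq_of_ne hts, zero_sub, neg_ne_zero] at ht
    obtain ⟨ν, rfl, hν⟩ := exists_isFacet_of_simplexBoundary_ne_zero ht
    have hνa := hf.facet_mem_sublevel h hτ hστ hν (fun e => hts (congrArg _ e)) hsa
    refine ⟨⟨sublevel_mono f h.1.le hνa, .inl hνa⟩, ?_⟩
    have h1 := hν.card
    have h2 := hστ.card
    simp only [Set.mem_ofPred_eq] at hsq ⊢
    omega
  have hbd : simplexBoundary F (τ : Finset V) ∈ boundaries F (sublevel f c) q := by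
    refine ⟨Finsupp.single (τ : Finset V) 1, Finsupp.single_mem_supported _ _ ⟨hτc, ?_⟩, ?_⟩
    · rw [hστ.card, hsq]
    · rw [boundary_single, one_smul]
  have := Submodule.smul_mem _ ε⁻¹ (Submodule.add_mem_sup hrest hbd)
  rwa [sub_add_cancel, Finsupp.smul_single, smul_eq_mul, inv_mul_cancel₀ hε0] at this

/-- Modulo boundaries, a chain of `K(c)` whose boundary lies in an earlier sub-level complex can be
moved into that complex, up to critical simplices of value `c`. -/
theorem exists_sub_mem_supported (hf : IsDiscreteMorse f) (h : IsPred f a c) {q : ℕ}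
    {x : Finset V →₀ F} (hx : x ∈ chains F (sublevel f c) q)
    (hbx : boundary F x ∈
      Finsupp.supported F F ((sublevel f a : Set (Finset V)) ∪ criticalFaces f c)) :
    ∃ w ∈ boundaries F (sublevel f c) q, x - w ∈
      Finsupp.supported F F {s | (s ∈ sublevel f a ∨ s ∈ criticalFaces f c) ∧ s.card = q + 1} := by
  obtain ⟨y, hy, w, hw, rfl⟩ :=
    Submodule.mem_sup.1 (chains_le_unpaired_sup_boundaries hf h q hx)
  refine ⟨w, hw, ?_⟩
  have hbw : boundary F w = 0 := (boundaries_le_cycles F _ _ hw).2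
  rw [map_add, hbw, add_zero] at hbx
  rw [add_sub_cancel_right]
  refine mem_supported_of_forall fun s hs => ?_
  obtain ⟨⟨hsc, hsu⟩, hsq⟩ := mem_of_mem_supported hy hs
  refine ⟨?_, hsq⟩
  by_contra! hcon
  obtain ⟨hsa, hcrit⟩ := hcon
  replace hsu := hsu.resolve_left hsa
  obtain ⟨τ, rfl⟩ := exists_of_mem_sublevel hsc
  have hτ : f τ = c := (hf.eq_or_exists_cofacet h hsc hsa).resolve_right
    fun ⟨ρ, hρ, hρc⟩ => hsu τ ρ rfl hρ hρc
  -- τ is new, has no cofacet of value `c` and is not critical, so it must be the upper simplex of a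
  -- gradient pair.
  obtain ⟨ν, hν, hνc⟩ : ∃ ν, IsFacet ν τ ∧ c ≤ f ν := by
    by_contra! hno
    refine hcrit ⟨τ, rfl, isCritical_of_forall (fun ρ hρ => ?_) (fun ν hν => hτ ▸ hno ν hν), hτ⟩
    by_contra! hle
    exact hsu τ ρ rfl hρ ((hle.trans hτ.le).antisymm (h.le_of_notMem hρ.1 hsa))
  have hνa := hf.notMem_sublevel_of_le h.1 hτ hν hνc
  -- No other simplex of `y` can cancel this coefficient: one containing ν as a facet would be new,
  -- hence of value `c`, and ν has only one cofacet of value at most `f ν`.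
  have hval : boundary F y ν ≠ 0 := by
    rw [boundary_apply, Finsupp.sum, Finset.sum_eq_single_of_mem _ (Finsupp.mem_support_iff.2 hs)]
    · exact mul_ne_zero hs (simplexBoundary_ne_zero_of_isFacet hν)
    · intro t ht htτ
      rw [mul_eq_zero, or_iff_not_imp_right]
      intro htν
      obtain ⟨⟨htc, htu⟩, -⟩ := mem_of_mem_supported hy (Finsupp.mem_support_iff.1 ht)
      obtain ⟨ρ, rfl⟩ := exists_of_mem_sublevel htc
      obtain ⟨ν', hν', hνρ⟩ := exists_isFacet_of_simplexBoundary_ne_zero htν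
      obtain rfl : ν' = ν := Subtype.ext hν'
      have hρa : (ρ : Finset V) ∉ sublevel f a := fun hρa =>
        hνa (((sublevel f a).isRelLowerSet_faces hρa).2 hνρ.1 (K.isRelLowerSet_faces ν'.2).1)
      have hρ : f ρ = c := (hf.eq_or_exists_cofacet h htc hρa).resolve_right
        fun ⟨π, hπ, hπc⟩ => htu.resolve_left hρa ρ π rfl hπ hπc
      exact absurd (congrArg _ (hf.cofacet_unique hνρ hν (hρ.le.trans hνc) (hτ.le.trans hνc))) htτ
  rcases mem_of_mem_supported hbx hval with hmem | ⟨ν', hν', hcr, hν'c⟩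
  · exact hνa hmem
  · obtain rfl : ν' = ν := Subtype.ext hν'
    exact absurd (hcr.lt_cofacet hν) (by linarith)

end Reduction

/-! ### The effect of a critical simplex on homology -/

section CriticalValue

variable {V : Type*} [LinearOrder V] {K : PreAbstractSimplicialComplex V} (F : Type*) [Field F]
  (f : K → ℝ)

/-- The cycles of `K(d)` whose classes come from `K(a)`, for `a ≤ d`. -/
noncomputable def olderCycles (q : ℕ) (a d : ℝ) : Submodule F (Finset V →₀ F) :=
  cycles F (sublevel f a) q ⊔ boundaries F (sublevel f d) q

/-- The simplex `σ` closes a cycle when it is attached to `K(a)`. -/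
def IsPositive (a : ℝ) (σ : K) : Prop :=
  boundary F (Finsupp.single (σ : Finset V) 1) ∈
    (chains F (sublevel f a) (dim σ)).map (boundary F)

variable {F f} {q : ℕ} {a b c : ℝ}

theorem boundary_eq_zero {L : PreAbstractSimplicialComplex V} {z : Finset V →₀ F}
    (hz : z ∈ cycles F L q) : boundary F z = 0 := hz.2

theorem mem_cycles {L : PreAbstractSimplicialComplex V} {z : Finset V →₀ F}
    (hz : z ∈ chains F L q) (hbz : boundary F z = 0) : z ∈ cycles F L q := ⟨hz, hbz⟩

theorem boundary_mem_boundaries {L : PreAbstractSimplicialComplex V} {x : Finset V →₀ F}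
    (hx : x ∈ chains F L (q + 1)) : boundary F x ∈ boundaries F L q :=
  Submodule.mem_map_of_mem hx

/-- Modulo boundaries, a chain of `K(c)` whose boundary lies in an earlier sub-level complex can be
moved into that complex, up to a multiple of the critical simplex of value `c`. -/
theorem IsExcellent.exists_decomposition (hf : IsExcellent f) (h : IsPred f a c)
    {x : Finset V →₀ F} (hx : x ∈ chains F (sublevel f c) q)
    (hbx : boundary F x ∈
      Finsupp.supported F F ((sublevel f a : Set (Finset V)) ∪ criticalFaces f c)) :
    ∃ w ∈ boundaries F (sublevel f c) q, x - w ∈ chains F (sublevel f a) q ∨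
      ∃ σ : K, IsCritical f σ ∧ f σ = c ∧ dim σ = q ∧ ∃ r : F, r ≠ 0 ∧
        x - w - Finsupp.single (σ : Finset V) r ∈ chains F (sublevel f a) q := by
  obtain ⟨w, hw, hxw⟩ := exists_sub_mem_supported hf.1 h hx hbx
  refine ⟨w, hw, ?_⟩
  by_cases hcr : ∃ s ∈ criticalFaces f c, (x - w) s ≠ 0
  · right
    obtain ⟨_, ⟨σ, rfl, hσ, hσc⟩, hs⟩ := hcr
    have hd := (mem_of_mem_supported hxw hs).2
    rw [card_eq_dim_add_one] at hd
    refine ⟨σ, hσ, hσc, by omega, _, hs, mem_supported_of_forall fun t ht => ?_⟩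
    have hne : t ≠ σ := by
      rintro rfl
      simp at ht
    rw [Finsupp.sub_apply, Finsupp.single_eq_of_ne hne, sub_zero] at ht
    obtain ⟨h1 | ⟨τ, rfl, hτ, hτc⟩, h2⟩ := mem_of_mem_supported hxw ht
    · exact ⟨h1, h2⟩
    · exact absurd (congrArg _ (hf.2 τ σ hτ hσ (hτc.trans hσc.symm))) hne
  · left
    push Not at hcr
    refine mem_supported_of_forall fun t ht => ?_
    obtain ⟨h1 | h1, h2⟩ := mem_of_mem_supported hxw ht
    · exact ⟨h1, h2⟩
    · exact absurd (hcr t h1) ht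

/-- A class that is born at `c` is born by a positive critical simplex. -/
theorem IsExcellent.exists_positive (hf : IsExcellent f) (h : IsPred f a c) {z : Finset V →₀ F}
    (hz : z ∈ cycles F (sublevel f c) q) (hza : z ∉ olderCycles F f q a c) :
    ∃ σ : K, IsCritical f σ ∧ f σ = c ∧ dim σ = q ∧ IsPositive F f a σ := by
  have hbz := boundary_eq_zero hz
  obtain ⟨w, hw, hzw | ⟨σ, hσ, hσc, hd, r, hr, hy⟩⟩ :=
    hf.exists_decomposition h hz.1 (by rw [hbz]; exact Submodule.zero_mem _)
  · refine absurd ?_ hza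
    rw [← sub_add_cancel z w]
    refine Submodule.add_mem_sup (mem_cycles hzw ?_) hw
    rw [map_sub, hbz, boundary_eq_zero (boundaries_le_cycles F _ _ hw), sub_zero]
  -- The old chain `z - w - rσ` has boundary `-r ∂σ`, since `z` and `w` are cycles.
  · refine ⟨σ, hσ, hσc, hd, (-r⁻¹) • _, Submodule.smul_mem _ _ (hd ▸ hy), ?_⟩
    rw [map_smul, map_sub, map_sub, hbz, boundary_eq_zero (boundaries_le_cycles F _ _ hw), sub_zero,
      zero_sub, smul_neg, neg_smul, neg_neg, ← map_smul, Finsupp.smul_single, smul_eq_mul,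
      inv_mul_cancel₀ hr]

/-- A cycle that becomes a boundary at `c` is, modulo boundaries, a multiple of the boundary of a
critical simplex. -/
theorem IsExcellent.exists_negative (hf : IsExcellent f) (h : IsPred f a c) {z : Finset V →₀ F}
    (hza : z ∈ chains F (sublevel f a) q) (hz : z ∈ boundaries F (sublevel f c) q)
    (hza' : z ∉ boundaries F (sublevel f a) q) :
    ∃ σ : K, IsCritical f σ ∧ f σ = c ∧ dim σ = q + 1 ∧ ¬ IsPositive F f a σ ∧ ∃ r : F, r ≠ 0 ∧
      z - r • boundary F (Finsupp.single (σ : Finset V) 1) ∈ boundaries F (sublevel f a) q := by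
  obtain ⟨x, hx, rfl⟩ := hz
  obtain ⟨w, hw, hxw | ⟨σ, hσ, hσc, hd, r, hr, hy⟩⟩ :=
    hf.exists_decomposition h hx (chains_le_supported_union _ _ hza)
  · refine absurd ?_ hza'
    have := boundary_mem_boundaries hxw
    rwa [map_sub, boundary_eq_zero (boundaries_le_cycles F _ _ hw), sub_zero] at this
  · have hmem := boundary_mem_boundaries hy
    rw [map_sub, map_sub, boundary_eq_zero (boundaries_le_cycles F _ _ hw), sub_zero,
      ← mul_one r, ← smul_eq_mul, ← Finsupp.smul_single, map_smul] at hmem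
    refine ⟨σ, hσ, hσc, hd, fun hpos => hza' ?_, r, hr, hmem⟩
    rw [IsPositive, hd] at hpos
    rw [← sub_add_cancel (boundary F x) (r • boundary F (Finsupp.single (σ : Finset V) 1))]
    exact Submodule.add_mem _ hmem (Submodule.smul_mem _ _ hpos)

/-- A positive critical simplex adds exactly one class, up to scalars and older classes. -/
theorem IsExcellent.exists_generator (hf : IsExcellent f) {σ : K} (hσ : IsCritical f σ)
    (h : IsPred f a (f σ)) (hpos : IsPositive F f a σ) :
    ∃ z ∈ cycles F (sublevel f (f σ)) (dim σ), z ∉ olderCycles F f (dim σ) a (f σ) ∧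
      ∀ z' ∈ cycles F (sublevel f (f σ)) (dim σ), ∃ r : F,
        z' - r • z ∈ olderCycles F f (dim σ) a (f σ) := by
  obtain ⟨y, hy, hby⟩ := hpos
  have hσc : Finsupp.single (σ : Finset V) (1 : F) ∈ chains F (sublevel f (f σ)) (dim σ) :=
    Finsupp.single_mem_supported _ _
      ⟨mem_sublevel_of_le subset_rfl le_rfl, card_eq_dim_add_one σ⟩
  have hyc := chains_mono F (dim σ) (sublevel_mono f h.1.le) hy
  have hb : boundary F (Finsupp.single (σ : Finset V) 1 - y) = 0 := by
    rw [map_sub, hby, sub_self]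
  refine ⟨Finsupp.single (σ : Finset V) 1 - y, ⟨Submodule.sub_mem _ hσc hyc, hb⟩, ?_, ?_⟩
  · intro hmem
    obtain ⟨u, hu, _, ⟨x, hx, rfl⟩, hsum⟩ := Submodule.mem_sup.1 hmem
    -- If the new cycle σ - y were older, σ would occur in a boundary ∂x. As σ is the only critical
    -- simplex of its value and has the wrong dimension to occur in `x`, the chain `x` can be moved
    -- into K(a), which would put σ there. This is why the decomposition tolerates critical
    -- simplices in the boundary.
    have hbx : boundary F x = Finsupp.single (σ : Finset V) 1 - (y + u) := by
      rw [sub_add_eq_sub_sub, ← hsum, add_sub_cancel_left]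
    obtain ⟨w, hw, hxw | ⟨τ, hτ, hτc, hd, -⟩⟩ := hf.exists_decomposition h hx (by
      rw [hbx]
      refine Submodule.sub_mem _ (Finsupp.single_mem_supported _ _ (.inr ⟨σ, rfl, hσ, rfl⟩)) ?_
      exact chains_le_supported_union _ _ (Submodule.add_mem _ hy hu.1))
    · have hm := boundaries_le_chains _ _ (boundary_mem_boundaries hxw)
      rw [map_sub, boundary_eq_zero (boundaries_le_cycles F _ _ hw), sub_zero, hbx] at hm
      have hs := Submodule.add_mem _ hm (Submodule.add_mem _ hy hu.1)
      rw [sub_add_cancel] at hs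
      exact hσ.notMem_sublevel hf.1 h.1 (mem_of_mem_supported hs (by simp)).1
    · have := hf.2 τ σ hτ hσ hτc
      subst this
      omega
  · intro z' hz'
    have hbz := boundary_eq_zero hz'
    obtain ⟨w, hw, hzw | ⟨τ, hτ, hτc, -, r, -, hz⟩⟩ :=
      hf.exists_decomposition h hz'.1 (by rw [hbz]; exact Submodule.zero_mem _)
    · refine ⟨0, ?_⟩
      rw [zero_smul, sub_zero, ← sub_add_cancel z' w]
      refine Submodule.add_mem_sup (mem_cycles hzw ?_) hw
      rw [map_sub, hbz, boundary_eq_zero (boundaries_le_cycles F _ _ hw),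
        sub_zero]
    · have := hf.2 τ σ hτ hσ hτc
      subst this
      refine ⟨r, ?_⟩
      have e : z' - r • (Finsupp.single (τ : Finset V) 1 - y) =
          (z' - w - Finsupp.single (τ : Finset V) r + r • y) + w := by
        rw [smul_sub, Finsupp.smul_single, smul_eq_mul, mul_one]
        abel
      have hbe := congrArg (boundary F) e
      rw [map_sub, map_smul, hb, smul_zero, sub_zero, hbz, map_add,
        boundary_eq_zero (boundaries_le_cycles F _ _ hw), add_zero] at hbe
      rw [e]
      exact Submodule.add_mem_sup
        ⟨Submodule.add_mem _ hz (Submodule.smul_mem _ _ hy), hbe.symm⟩ hw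

/-- The boundary of a negative critical simplex is a new boundary. -/
theorem IsCritical.boundary_of_not_positive {σ : K} (hσ : IsCritical f σ)
    (h : IsPred f a (f σ)) (hneg : ¬ IsPositive F f a σ) :
    ∃ p, dim σ = p + 1 ∧
      boundary F (Finsupp.single (σ : Finset V) 1) ∈ cycles F (sublevel f a) p ∧
      boundary F (Finsupp.single (σ : Finset V) 1) ∈ boundaries F (sublevel f (f σ)) p ∧
      boundary F (Finsupp.single (σ : Finset V) 1) ∉ boundaries F (sublevel f a) p := by
  have hcard := card_eq_dim_add_one σ
  obtain ⟨p, hp⟩ : ∃ p, dim σ = p + 1 := by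
    -- A vertex has zero boundary in unreduced homology and is therefore positive.
    refine Nat.exists_eq_succ_of_ne_zero fun h0 => hneg ?_
    rw [IsPositive, boundary_single, simplexBoundary, if_pos (by omega), smul_zero]
    exact Submodule.zero_mem _
  refine ⟨p, hp, ⟨?_, boundary_boundary F _⟩, boundary_mem_boundaries
    (Finsupp.single_mem_supported _ _ ⟨mem_sublevel_of_le subset_rfl le_rfl, hp ▸ hcard⟩), ?_⟩
  · rw [boundary_single, one_smul]
    refine mem_supported_of_forall fun s hs => ?_
    obtain ⟨ν, rfl, hν⟩ := exists_isFacet_of_simplexBoundary_ne_zero hs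
    refine ⟨h.mem_sublevel_of_lt subset_rfl (hσ.facet_lt hν), ?_⟩
    have := hν.card
    omega
  · rwa [IsPositive, hp] at hneg

end CriticalValue

/-! ### Birth and death in terms of cycles -/

section Classes

variable {V : Type*} [LinearOrder V] {K : PreAbstractSimplicialComplex V} {F : Type*} [Field F]
  {f : K → ℝ} {q : ℕ} {a b d : ℝ} {z : Finset V →₀ F}

/-- The homology class of a cycle. -/
noncomputable def homologyClass {L : PreAbstractSimplicialComplex V} {z : Finset V →₀ F}
    (hz : z ∈ cycles F L q) : Homology F L q :=
  Submodule.Quotient.mk ⟨z, hz⟩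

theorem exists_homologyClass_eq {L : PreAbstractSimplicialComplex V} (h : Homology F L q) :
    ∃ (z : Finset V →₀ F) (hz : z ∈ cycles F L q), homologyClass hz = h := by
  obtain ⟨⟨z, hz⟩, rfl⟩ := Submodule.Quotient.mk_surjective _ h
  exact ⟨z, hz, rfl⟩

theorem homologyClass_eq_iff {L : PreAbstractSimplicialComplex V} {z z' : Finset V →₀ F}
    (hz : z ∈ cycles F L q) (hz' : z' ∈ cycles F L q) :
    homologyClass hz = homologyClass hz' ↔ z - z' ∈ boundaries F L q := by
  rw [homologyClass, homologyClass, Submodule.Quotient.eq]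
  rfl

theorem levelMap_homologyClass (hz : z ∈ cycles F (sublevel f b) q) (hbd : b ≤ d) :
    levelMap F f q hbd (homologyClass hz) =
      homologyClass (cycles_mono F q (sublevel_mono f hbd) hz) :=
  rfl

/-- All cycle and boundary spaces sit in one ambient space, so classes at different levels are
compared through their representatives. -/
theorem levelMap_mem_range_iff (hz : z ∈ cycles F (sublevel f b) q) (hbd : b ≤ d) (had : a ≤ d) :
    levelMap F f q hbd (homologyClass hz) ∈ LinearMap.range (levelMap F f q had) ↔
      z ∈ olderCycles F f q a d := by
  rw [levelMap_homologyClass, LinearMap.mem_range, olderCycles, Submodule.mem_sup]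
  constructor
  · rintro ⟨h, hh⟩
    obtain ⟨y, hy, rfl⟩ := exists_homologyClass_eq h
    rw [levelMap_homologyClass, eq_comm, homologyClass_eq_iff] at hh
    exact ⟨y, hy, _, hh, add_sub_cancel _ _⟩
  · rintro ⟨y, hy, w, hw, rfl⟩
    refine ⟨homologyClass hy, ?_⟩
    rwa [levelMap_homologyClass, eq_comm, homologyClass_eq_iff, add_sub_cancel_left]

theorem olderCycles_mono {a' d' : ℝ} (ha : a ≤ a') (hd : d ≤ d') :
    olderCycles F f q a d ≤ olderCycles F f q a' d' :=
  sup_le_sup (cycles_mono F q (sublevel_mono f ha)) (boundaries_mono F q (sublevel_mono f hd))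

theorem IsPred.olderCycles_le (h : IsPred f a b) {a' : ℝ} (ha' : a' < b) :
    olderCycles F f q a' d ≤ olderCycles F f q a d :=
  sup_le_sup_right (cycles_mono F q (h.sublevel_le ha')) _

/-- Every K(a') with `a' < b` is contained in K(a), so the predecessor `a` alone decides whether an
older class exists. -/
theorem hasMerged_iff (h : IsPred f a b) (hz : z ∈ cycles F (sublevel f b) q) (hbd : b ≤ d) :
    HasMerged (homologyClass hz) hbd ↔ z ∈ olderCycles F f q a d := by
  simp only [HasMerged, levelMap_mem_range_iff]
  exact ⟨fun ⟨a', ha', hm⟩ => h.olderCycles_le ha' hm, fun hm => ⟨a, h.1, hm⟩⟩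

theorem isBorn_iff (h : IsPred f a b) (hz : z ∈ cycles F (sublevel f b) q) :
    IsBorn (homologyClass hz) ↔ z ∉ olderCycles F f q a b := by
  have key : ∀ a' (ha' : a' < b), homologyClass hz ∉ LinearMap.range (levelMap F f q ha'.le) ↔
      z ∉ olderCycles F f q a' b := fun a' ha' =>
    not_congr (levelMap_mem_range_iff hz le_rfl ha'.le)
  constructor
  · exact fun hb => (key a h.1).1 (hb a h.1)
  · exact fun hb a' ha' => (key a' ha').2 fun hm => hb (h.olderCycles_le ha' hm)

theorem diesAt_iff (h : IsPred f a b) (hz : z ∈ cycles F (sublevel f b) q) :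
    DiesAt (homologyClass hz) d ↔ b < d ∧ z ∈ olderCycles F f q a d ∧
      ∀ c, b ≤ c → c < d → z ∉ olderCycles F f q a c := by
  constructor
  · rintro ⟨hbd, hm, hn⟩
    exact ⟨hbd, (hasMerged_iff h hz hbd.le).1 hm, fun c hbc hcd hc =>
      hn c hbc hcd ((hasMerged_iff h hz hbc).2 hc)⟩
  · rintro ⟨hbd, hm, hn⟩
    exact ⟨hbd, (hasMerged_iff h hz hbd.le).2 hm, fun c hbc hcd hc =>
      hn c hbc hcd ((hasMerged_iff h hz hbc).1 hc)⟩

/-- A class of `K(c)` that is not zero comes from a sub-level complex at a first value of `f`. -/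
theorem exists_first_value (hK : (K : Set (Finset V)).Finite) {c : ℝ}
    (hz : z ∈ cycles F (sublevel f c) q) (hzc : z ∉ boundaries F (sublevel f c) q) :
    ∃ α : K, f α ≤ c ∧ z ∈ olderCycles F f q (f α) c ∧
      ∀ b, z ∈ olderCycles F f q b c → f α ≤ b := by
  have : Finite K := hK
  -- Rounding `b` down to the largest value of `f` not above it keeps all of K(b); thus the first
  -- level is a minimum over finitely many values.
  have key : ∀ b ≤ c, z ∈ olderCycles F f q b c →
      ∃ α : K, (f α ≤ c ∧ z ∈ olderCycles F f q (f α) c) ∧ f α ≤ b := by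
    intro b hbc hb
    have hne : {α : K | f α ≤ b}.Nonempty := by
      by_contra! hemp
      -- With no simplex of value at most `b`, K(b) is empty and `z` would be a boundary.
      refine hzc ((?_ : olderCycles F f q b c ≤ _) hb)
      refine sup_le ?_ le_rfl
      rintro y ⟨hy, -⟩
      have : y = 0 := by
        ext s
        by_contra hs
        obtain ⟨⟨-, σ, hσ, -⟩, -⟩ := mem_of_mem_supported hy hs
        exact Set.eq_empty_iff_forall_notMem.1 hemp σ hσ
      rw [this]
      exact Submodule.zero_mem _
    obtain ⟨α, hα, hmax⟩ := Set.exists_max_image _ f (Set.toFinite _) hne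
    refine ⟨α, ⟨hα.trans hbc, ?_⟩, hα⟩
    exact sup_le_sup_right (cycles_mono F q (sublevel_le_of_forall fun σ hσ => hmax σ hσ)) _ hb
  obtain ⟨α₀, hα₀, -⟩ := key c le_rfl (Submodule.mem_sup_left hz)
  obtain ⟨α, ⟨hαc, hα⟩, hmin⟩ := Set.exists_min_image
    {α : K | f α ≤ c ∧ z ∈ olderCycles F f q (f α) c} f (Set.toFinite _) ⟨α₀, hα₀⟩
  refine ⟨α, hαc, hα, fun b hb => ?_⟩
  rcases le_total b c with hbc | hbc
  · obtain ⟨α', hα', hle⟩ := key b hbc hb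
    exact (hmin α' hα').trans hle
  · exact hαc.trans hbc

end Classes

/-! ### The pairing -/

section Pairing

variable {V : Type*} [LinearOrder V] {K : PreAbstractSimplicialComplex V} {F : Type*} [Field F]
  {f : K → ℝ} {q : ℕ} {a b d : ℝ} {z z' : Finset V →₀ F}

theorem IsExcellent.eq_dim_and_isPositive (hf : IsExcellent f) {σ : K} (hσ : IsCritical f σ)
    (h : IsPred f a (f σ)) (hz : z ∈ cycles F (sublevel f (f σ)) q)
    (hza : z ∉ olderCycles F f q a (f σ)) : q = dim σ ∧ IsPositive F f a σ := by
  obtain ⟨σ', hσ', hv, hd, hpos⟩ := hf.exists_positive h hz hza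
  obtain rfl := hf.2 _ _ hσ' hσ hv
  exact ⟨hd.symm, hpos⟩

/-- A class dies at `d` because it differs from an older one by a cycle that becomes a boundary
at `d`. -/
theorem DiesAt.exists_older_add (h : IsPred f a b) {d₀ : ℝ} (hd : IsPred f d₀ d) (hbd : b ≤ d₀)
    (hz : z ∈ cycles F (sublevel f b) q) (hdies : DiesAt (homologyClass hz) d) :
    ∃ y ∈ cycles F (sublevel f a) q, ∃ w ∈ cycles F (sublevel f d₀) q,
      z = y + w ∧ w ∈ boundaries F (sublevel f d) q ∧ w ∉ boundaries F (sublevel f d₀) q := by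
  obtain ⟨-, hzd, hn⟩ := (diesAt_iff h hz).1 hdies
  obtain ⟨y, hy, w, hw, rfl⟩ := Submodule.mem_sup.1 hzd
  refine ⟨y, hy, w, ?_, rfl, hw, fun hw' => hn d₀ hbd hd.1 (Submodule.add_mem_sup hy hw')⟩
  have := Submodule.sub_mem _ (cycles_mono F q (sublevel_mono f hbd) hz)
    (cycles_mono F q (sublevel_mono f (h.1.le.trans hbd)) hy)
  rwa [add_sub_cancel_left] at this

/-- A class can only die at a negative critical simplex, of one dimension higher. -/
theorem DiesAt.exists_negative (hf : IsExcellent f) (h : IsPred f a b) {d₀ : ℝ}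
    (hd : IsPred f d₀ d) (hbd : b ≤ d₀) (hz : z ∈ cycles F (sublevel f b) q)
    (hdies : DiesAt (homologyClass hz) d) :
    ∃ τ : K, IsCritical f τ ∧ f τ = d ∧ dim τ = q + 1 ∧ ¬ IsPositive F f d₀ τ := by
  obtain ⟨y, hy, w, hw, -, hwd, hwd₀⟩ := hdies.exists_older_add h hd hbd hz
  obtain ⟨τ, hτ, hτd, hdim, hneg, -⟩ := hf.exists_negative hd hw.1 hwd hwd₀
  exact ⟨τ, hτ, hτd, hdim, hneg⟩

theorem diesAt_unique {d' : ℝ} (h : IsPred f a b) (hz : z ∈ cycles F (sublevel f b) q)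
    (hd : DiesAt (homologyClass hz) d) (hd' : DiesAt (homologyClass hz) d') : d = d' := by
  obtain ⟨h1, h2, h3⟩ := (diesAt_iff h hz).1 hd
  obtain ⟨h1', h2', h3'⟩ := (diesAt_iff h hz).1 hd'
  rcases lt_trichotomy d d' with hlt | heq | hlt
  · exact absurd h2 (h3' d h1.le hlt)
  · exact heq
  · exact absurd h2' (h3 d' h1'.le hlt)

/-- Agreement up to a nonzero factor and older cycles persists from level `c` to all later levels.
-/
theorem mem_olderCycles_congr {c : ℝ} {r : F} (hr : r ≠ 0) (hcd : c ≤ d)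
    (hzz : z' - r • z ∈ olderCycles F f q a c) :
    z' ∈ olderCycles F f q a d ↔ z ∈ olderCycles F f q a d := by
  have hm := olderCycles_mono le_rfl hcd hzz
  rw [← Submodule.sub_mem_iff_left _ hm, sub_sub_cancel, Submodule.smul_mem_iff _ hr]

/-- All classes born at a critical simplex die at the same values. -/
theorem diesAt_congr (h : IsPred f a b) {r : F} (hr : r ≠ 0)
    (hz : z ∈ cycles F (sublevel f b) q) (hz' : z' ∈ cycles F (sublevel f b) q)
    (hzz : z' - r • z ∈ olderCycles F f q a b) :
    DiesAt (homologyClass hz') d ↔ DiesAt (homologyClass hz) d := by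
  rw [diesAt_iff h, diesAt_iff h]
  refine and_congr_right fun hbd => and_congr (mem_olderCycles_congr hr hbd.le hzz) ?_
  exact forall_congr' fun c => forall_congr' fun hbc => forall_congr' fun _ =>
    not_congr (mem_olderCycles_congr hr hbc hzz)

/-- A positive critical simplex carries a single class, up to the choice of a representative: every
class born there dies at the same values. -/
theorem IsExcellent.exists_born_class (hf : IsExcellent f) {σ : K} (hσ : IsCritical f σ)
    (h : IsPred f a (f σ)) (hpos : IsPositive F f a σ) :
    ∃ (z : Finset V →₀ F) (hz : z ∈ cycles F (sublevel f (f σ)) (dim σ)),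
      z ∉ olderCycles F f (dim σ) a (f σ) ∧
      ∀ (p : ℕ) (g : Homology F (sublevel f (f σ)) p), IsBorn g →
        ∀ d, DiesAt g d ↔ DiesAt (homologyClass hz) d := by
  obtain ⟨z, hz, hza, hgen⟩ := hf.exists_generator hσ h hpos
  refine ⟨z, hz, hza, fun p g hg d => ?_⟩
  obtain ⟨z', hz', rfl⟩ := exists_homologyClass_eq g
  have hza' := (isBorn_iff h hz').1 hg
  obtain ⟨rfl, -⟩ := hf.eq_dim_and_isPositive hσ h hz' hza'
  obtain ⟨r, hr⟩ := hgen z' hz'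
  refine diesAt_congr h (fun hr0 => hza' ?_) hz hz' hr
  rwa [hr0, zero_smul, sub_zero] at hr

theorem IsPersistencePair.lt {α σ : K} (hp : IsPersistencePair F f α σ) : f α < f σ :=
  let ⟨_, _, _, hlt, _⟩ := hp
  hlt

/-- A death needs a negative critical simplex of that value, and excellence leaves only σ. -/
theorem IsPersistencePair.not_isPositive (hK : (K : Set (Finset V)).Finite) (hf : IsExcellent f)
    {α σ : K} (hσ : IsCritical f σ) (h : IsPred f a (f σ)) (hαa : f α ≤ a)
    (hp : IsPersistencePair F f α σ) : ¬ IsPositive F f a σ := by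
  obtain ⟨p, g, -, hdies⟩ := hp
  obtain ⟨z, hz, rfl⟩ := exists_homologyClass_eq g
  obtain ⟨b₀, -, hb₀⟩ := exists_isPred hK f (sub_one_lt (f α))
  obtain ⟨τ, hτ, hτd, -, hneg⟩ := hdies.exists_negative hf hb₀ h hαa hz
  obtain rfl := hf.2 _ _ hτ hσ hτd
  exact hneg

/-- A positive critical simplex is the birth simplex of exactly one persistence pair, or is paired
with infinity. -/
theorem IsExcellent.pairing_of_isPositive (hK : (K : Set (Finset V)).Finite) (hf : IsExcellent f)
    {σ : K} (hσ : IsCritical f σ) (h : IsPred f a (f σ)) (hpos : IsPositive F f a σ) :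
    ((∃ τ : K, dim τ = dim σ + 1 ∧ IsCritical f τ ∧ IsPersistencePair F f σ τ ∧
        ∀ τ' : K, IsCritical f τ' → IsPersistencePair F f σ τ' → τ' = τ) ∧
      ¬ IsPairedWithInfinity F f σ) ∨
    ((¬ ∃ τ : K, IsPersistencePair F f σ τ) ∧ IsPairedWithInfinity F f σ) := by
  obtain ⟨z, hz, hza, hcongr⟩ := hf.exists_born_class hσ h hpos
  have hborn := (isBorn_iff h hz).2 hza
  by_cases hd : ∃ d, DiesAt (homologyClass hz) d
  · left
    obtain ⟨d, hd⟩ := hd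
    have hd' := (diesAt_iff h hz).1 hd
    obtain ⟨d₀, hle, hd₀⟩ := exists_isPred hK f hd'.1
    obtain ⟨τ, hτ, rfl, hdim, -⟩ := hd.exists_negative hf h hd₀ hle hz
    refine ⟨⟨τ, hdim, hτ, ⟨_, _, hborn, hd⟩, ?_⟩, ?_⟩
    · rintro τ' hτ' ⟨p, g, hg, hdg⟩
      exact hf.2 _ _ hτ' hτ (diesAt_unique h hz ((hcongr p g hg _).1 hdg) hd)
    · rintro ⟨p, g, hg, hng⟩
      exact hng ⟨_, (hcongr p g hg _).2 hd⟩
  · right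
    refine ⟨?_, _, _, hborn, hd⟩
    rintro ⟨τ, p, g, hg, hdg⟩
    exact hd ⟨_, (hcongr p g hg _).1 hdg⟩

/-- No class is born at a negative critical simplex. -/
theorem IsExcellent.not_isBorn (hf : IsExcellent f) {σ : K} (hσ : IsCritical f σ)
    (h : IsPred f a (f σ)) (hneg : ¬ IsPositive F f a σ)
    (g : Homology F (sublevel f (f σ)) q) : ¬ IsBorn g := by
  intro hg
  obtain ⟨z, hz, rfl⟩ := exists_homologyClass_eq g
  exact hneg (hf.eq_dim_and_isPositive hσ h hz ((isBorn_iff h hz).1 hg)).2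

/-- A negative critical simplex is the death simplex of exactly one persistence pair. -/
theorem IsExcellent.exists_pair_of_not_isPositive (hK : (K : Set (Finset V)).Finite)
    (hf : IsExcellent f) {σ : K} (hσ : IsCritical f σ) (h : IsPred f a (f σ))
    (hneg : ¬ IsPositive F f a σ) :
    ∃ α : K, dim σ = dim α + 1 ∧ IsCritical f α ∧ IsPersistencePair F f α σ ∧
      ∀ α' : K, IsCritical f α' → IsPersistencePair F f α' σ → α' = α := by
  obtain ⟨p, hp, hzcyc, hzbd, hza⟩ := hσ.boundary_of_not_positive h hneg
  set z := boundary F (Finsupp.single (σ : Finset V) 1) with hzdef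
  -- The simplex β only supplies the birth value and need not be critical; the critical α of the
  -- same value comes from `exists_positive`.
  obtain ⟨β, hβa, hβ, hmin⟩ := exists_first_value hK hzcyc hza
  obtain ⟨y, hy, w, hw, hyw⟩ := Submodule.mem_sup.1 hβ
  obtain ⟨b₀, -, hb₀⟩ := exists_isPred hK f (sub_one_lt (f β))
  have hya : y ∉ olderCycles F f p b₀ a := by
    intro hy'
    have hzb : z ∈ olderCycles F f p b₀ a :=
      hyw ▸ Submodule.add_mem _ hy' (Submodule.mem_sup_right hw)
    exact (hmin b₀ hzb).not_gt hb₀.1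
  have hyb : y ∉ olderCycles F f p b₀ (f β) := fun hm => hya (olderCycles_mono le_rfl hβa hm)
  have hyd : y ∈ olderCycles F f p b₀ (f σ) := by
    rw [eq_sub_of_add_eq hyw]
    exact Submodule.mem_sup_right
      (Submodule.sub_mem _ hzbd (boundaries_mono F p (sublevel_mono f h.1.le) hw))
  -- Before `f σ` there are no more boundaries than in K(a), where `y` is not yet older.
  have hdies : DiesAt (homologyClass hy) (f σ) := by
    refine (diesAt_iff hb₀ hy).2 ⟨hβa.trans_lt h.1, hyd, fun c _ hc hm => hya ?_⟩
    exact sup_le_sup_left (boundaries_mono F p (h.sublevel_le hc)) _ hm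
  have hborn := (isBorn_iff hb₀ hy).2 hyb
  obtain ⟨α, hα, hαβ, hαdim, -⟩ := hf.exists_positive hb₀ hy hyb
  have hpair : IsPersistencePair F f α σ := by
    unfold IsPersistencePair
    rw [hαβ]
    exact ⟨p, _, hborn, hdies⟩
  refine ⟨α, by rw [hp, hαdim], hα, hpair, fun α' hα' hp' => hf.2 _ _ hα' hα ?_⟩
  have hα'a : f α' ≤ a := h.2 _ hp'.lt
  obtain ⟨p', g, -, hdies'⟩ := hp'
  obtain ⟨y', hy', rfl⟩ := exists_homologyClass_eq g
  obtain ⟨b₁, -, hb₁⟩ := exists_isPred hK f (sub_one_lt (f α'))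
  obtain ⟨x, hx, w', hw', hsum, hw'd, hw'a⟩ := hdies'.exists_older_add hb₁ h hα'a hy'
  -- The part `w'` that becomes a boundary at σ is a nonzero multiple of `z` modulo boundaries of
  -- K(a), so `w'` and `z` come from the same levels.
  obtain ⟨σ', hσ', hval, hdim, -, r, hr, hmem⟩ := hf.exists_negative h hw'.1 hw'd hw'a
  obtain rfl := hf.2 _ _ hσ' hσ hval
  obtain rfl : p' = p := by omega
  rw [← hzdef] at hmem
  have key : ∀ b, w' ∈ olderCycles F f p' b a ↔ z ∈ olderCycles F f p' b a := fun b =>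
    mem_olderCycles_congr hr le_rfl (Submodule.mem_sup_right hmem)
  have hle : f β ≤ f α' := by
    refine hmin _ ((key _).1 (Submodule.mem_sup_left ?_))
    rw [← add_sub_cancel_left x w', ← hsum]
    exact Submodule.sub_mem _ hy' (cycles_mono F p' (sublevel_mono f hb₁.1.le) hx)
  rw [hαβ]
  refine hle.antisymm' (not_lt.1 fun hlt => ?_)
  -- If β came before α', `w'` and hence `y'` would be older already at level `a`, before the
  -- supposed death.
  have hm : y' ∈ olderCycles F f p' b₁ a := by
    rw [hsum]
    exact Submodule.add_mem _ (Submodule.mem_sup_left hx) (hb₁.olderCycles_le hlt ((key _).2 hβ))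
  exact ((diesAt_iff hb₁ hy').1 hdies').2.2 a hα'a h.1 hm

end Pairing

end DMorse

theorem theorem3p6 {V : Type*} [LinearOrder V] {F : Type*} [Field F]
    (K : PreAbstractSimplicialComplex V) (hK : (K : Set (Finset V)).Finite)
    (f : K → ℝ) (hf : DMorse.IsExcellent f)
    (q : ℕ) (σ : K) (hq : DMorse.dim σ = q) (hσ : DMorse.IsCritical f σ) :
    ((∃ τ : K, DMorse.dim τ = q + 1 ∧ DMorse.IsCritical f τ ∧ DMorse.IsPersistencePair F f σ τ ∧
          ∀ τ' : K, DMorse.IsCritical f τ' → DMorse.IsPersistencePair F f σ τ' → τ' = τ) ∧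
        (¬ ∃ α : K, DMorse.IsPersistencePair F f α σ) ∧
        ¬ DMorse.IsPairedWithInfinity F f σ) ∨
    ((¬ ∃ τ : K, DMorse.IsPersistencePair F f σ τ) ∧
        (∃ α : K, q = DMorse.dim α + 1 ∧ DMorse.IsCritical f α ∧ DMorse.IsPersistencePair F f α σ ∧
          ∀ α' : K, DMorse.IsCritical f α' → DMorse.IsPersistencePair F f α' σ → α' = α) ∧
        ¬ DMorse.IsPairedWithInfinity F f σ) ∨
    ((¬ ∃ τ : K, DMorse.IsPersistencePair F f σ τ) ∧
        (¬ ∃ α : K, DMorse.IsPersistencePair F f α σ) ∧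
        DMorse.IsPairedWithInfinity F f σ) := by
  subst hq
  obtain ⟨a, -, h⟩ := DMorse.exists_isPred hK f (sub_one_lt (f σ))
  by_cases hpos : DMorse.IsPositive F f a σ
  · have hno : ¬ ∃ α : K, DMorse.IsPersistencePair F f α σ := fun ⟨α, hα⟩ =>
      hα.not_isPositive hK hf hσ h (h.2 _ hα.lt) hpos
    rcases hf.pairing_of_isPositive hK hσ h hpos with ⟨h1, h2⟩ | ⟨h1, h2⟩
    · exact .inl ⟨h1, hno, h2⟩
    · exact .inr (.inr ⟨h1, hno, h2⟩)
  · refine .inr (.inl ⟨?_, hf.exists_pair_of_not_isPositive hK hσ h hpos, ?_⟩)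
    · rintro ⟨τ, p, g, hg, -⟩
      exact hf.not_isBorn hσ h hpos g hg
    · rintro ⟨p, g, hg, -⟩
      exact hf.not_isBorn hσ h hpos g hg
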